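/- **Theorem 1.** Let $m,n\ge 1$ be integers. Take finitely many copies $C_j$ ($j\in\mathcal J$, $|\mathcal J|=M$) of a cell $C=\{u,v,x_1,\dots,x_n\}$ with two internal sites $u,v$ and $n$ external sites, and form a finite lattice $\Lambda$ by identifying external sites of distinct cells in groups, so that every external site of $\Lambda$ belongs to exactly $m$ distinct cells (internal sites are not identified, nor are external sites of one and the same cell). Assume that $\Lambda$ is connected, i.e. the graph on $\Lambda$ in which two distinct sites are adjacent when they lie in a common cell is connected. Let $\mathcal E$ be the set of external sites of $\Lambda$, and let $u_j,v_j$ be the internal sites of $C_j$. Let $c_{r,\sigma}$ ($r\in\Lambda$, $\sigma=\uparrow,\downarrow$) be the electron annihilation operators on the fermionic Fock space over $\Lambda\times\{\uparrow,\downarrow\}$, and let $n_{r,\sigma}=c^\dagger_{r,\sigma}c_{r,\sigma}$. For real numbers $\nu>0$, $t>0$, $s'>0$ and $U>0$ put $$b_{j,\sigma}=c_{u_j,\sigma}+c_{v_j,\sigma}+\nu\sum_{x\in C_j\cap\mathcal E}c_{x,\sigma},\qquad d_{j,\sigma}=c_{u_j,\sigma}-c_{v_j,\sigma},$$ $$H=t\sum_{j\in\mathcal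 J}\sum_{\sigma=\uparrow,\downarrow} b^\dagger_{j,\sigma}b_{j,\sigma}+s'\sum_{j\in\mathcal J}\sum_{\sigma=\uparrow,\downarrow} d^\dagger_{j,\sigma}d_{j,\sigma}+U\sum_{r\in\Lambda}n_{r,\uparrow}n_{r,\downarrow}.$$ Let $\hat S^{(\alpha)}_{\rm tot}=\frac12\sum_{r\in\Lambda}\sum_{\sigma,\tau}c^\dagger_{r,\sigma}(p^{(\alpha)})_{\sigma,\tau}c_{r,\tau}$, $\alpha=1,2,3$, with the Pauli matrices $p^{(\alpha)}$. Let the electron number be $N_{\rm e}=|\mathcal E|$, and let $S_{\max}=N_{\rm e}/2$. Then $N_{\rm e}=n|\Lambda|/(2m+n)$, and for every $U>0$ the ground states of $H$ in the $N_{\rm e}$-electron space (the eigenvectors of $H$ with the least eigenvalue there) all have total spin $S_{\rm tot}=S_{\max}$, that is, $\sum_{\alpha}(\hat S^{(\alpha)}_{\rm tot})^2\Phi=S_{\max}(S_{\max}+1)\Phi$, and they are non-degenerate apart from the trivial $(2S_{\max}+1)$-fold degeneracy, that is, the space spanned by them has dimension $2S_{\max}+1$. -/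

import Mathlib

open scoped BigOperators

namespace FlatBand

noncomputable section

/-! Fermionic Fock space over a finite set `κ` of modes -/

section Fock

variable {κ : Type*} [Fintype κ] [DecidableEq κ]

/-- Fermionic Fock space over the modes `κ`, in the occupation-number representation: the
coordinate `ψ A` is the amplitude of the basis state in which exactly the modes in `A` are
occupied. -/
abbrev Fock (κ : Type*) [Fintype κ] : Type _ := EuclideanSpace ℂ (Finset κ)

/-- The fermionic sign `(-1) ^ #{l ∈ A : l precedes k}` with respect to a fixed enumeration
of the modes. -/
def jwSign (k : κ) (A : Finset κ) : ℂ :=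
  (-1) ^ (A.filter (fun l => Fintype.equivFin κ l < Fintype.equivFin κ k)).card

/-- The annihilation operator of the mode `k`: it maps the basis state of `A` to
`jwSign k A` times the basis state of `A \ {k}` if `k ∈ A`, and to `0` otherwise. -/
def annihilate (k : κ) : Module.End ℂ (Fock κ) where
  toFun ψ := WithLp.toLp 2 fun A => if k ∈ A then 0 else jwSign k A * ψ (insert k A)
  map_add' ψ φ := by
    ext A
    by_cases h : k ∈ A <;> simp [h, mul_add]
  map_smul' z ψ := by
    ext A
    by_cases h : k ∈ A <;> simp [h, mul_left_comm]

end Fock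

/-! The lattice -/

/-- The sites: `Sum.inl (Sum.inl j)` and `Sum.inl (Sum.inr j)` are the internal sites `u_j`, `v_j`
of the cell `j : J`, and `Sum.inr x` is the external site `x : E`. -/
abbrev Site (J E : Type*) : Type _ := (J ⊕ J) ⊕ E

/-- Spin values: `0` is up and `1` is down. -/
abbrev Spin : Type := Fin 2

/-- The internal site `u_j`. -/
abbrev siteU {J E : Type*} (j : J) : Site J E := Sum.inl (Sum.inl j)

/-- The internal site `v_j`. -/
abbrev siteV {J E : Type*} (j : J) : Site J E := Sum.inl (Sum.inr j)

/-- The external site `x`. -/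
abbrev siteX {J E : Type*} (x : E) : Site J E := Sum.inr x

/-- A lattice assembled from copies, indexed by `J`, of a cell with two internal sites and `n`
external sites, by identifying external sites of distinct cells in groups of `m`: the site
`ext j i` of `E` is what the `i`-th external site of the `j`-th copy becomes. -/
structure CellLattice (n m : ℕ) (J E : Type*) where
  /-- The `i`-th external site of the cell `j`. -/
  ext : J → Fin n → E
  /-- External sites of one and the same cell are not identified with each other. -/
  ext_injective : ∀ j, Function.Injective (ext j)
  /-- Every external site belongs to exactly `m` cells. -/
  shared : ∀ x, {j | x ∈ Set.range (ext j)}.ncard = m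

namespace CellLattice

variable {n m : ℕ} {J E : Type*} (L : CellLattice n m J E)

/-- The cell `C_j = {u_j, v_j, x_1, …, x_n}` as a set of sites. -/
def cell (j : J) : Set (Site J E) :=
  {siteU j, siteV j} ∪ Set.range (fun i => siteX (L.ext j i))

/-- The graph on the sites in which two distinct sites are adjacent if they lie in a common
cell. -/
def graph : SimpleGraph (Site J E) where
  Adj r s := r ≠ s ∧ ∃ j, r ∈ L.cell j ∧ s ∈ L.cell j
  symm := ⟨fun _ _ h => ⟨h.1.symm, h.2.imp fun _ hj => ⟨hj.2, hj.1⟩⟩⟩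
  loopless := ⟨fun _ h => h.1 rfl⟩

end CellLattice

/-! The electron operators on a finite set `Λ` of sites -/

section Electrons

variable {Λ : Type*} [Fintype Λ] [DecidableEq Λ]

/-- The state space of electrons on `Λ`; a mode is a site with a spin. -/
abbrev ElectronSpace (Λ : Type*) [Fintype Λ] : Type _ := Fock (Λ × Spin)

/-- The annihilation operator `c_{r,σ}`. -/
def c (r : Λ) (σ : Spin) : Module.End ℂ (ElectronSpace Λ) := annihilate (r, σ)

/-- The number operator `n_{r,σ} = c†_{r,σ} c_{r,σ}`. -/
def num (r : Λ) (σ : Spin) : Module.End ℂ (ElectronSpace Λ) :=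
  LinearMap.adjoint (c r σ) * c r σ

variable (Λ) in
/-- The space of states with exactly `N` electrons: the eigenspace with eigenvalue `N` of the total
number operator. -/
def sector (N : ℕ) : Submodule ℂ (ElectronSpace Λ) :=
  Module.End.eigenspace (∑ r : Λ, ∑ σ : Spin, num r σ) (N : ℂ)

/-- The Pauli matrices. -/
def pauli : Fin 3 → Matrix Spin Spin ℂ :=
  ![!![0, 1; 1, 0], !![0, -Complex.I; Complex.I, 0], !![1, 0; 0, -1]]

variable (Λ) in
/-- The component `α` of the total spin operator. -/
def totalSpin (α : Fin 3) : Module.End ℂ (ElectronSpace Λ) :=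
  (1 / 2 : ℂ) • ∑ r : Λ, ∑ σ : Spin, ∑ τ : Spin,
    pauli α σ τ • (LinearMap.adjoint (c r σ) * c r τ)

variable (Λ) in
/-- The square of the total spin operator. -/
def totalSpinSq : Module.End ℂ (ElectronSpace Λ) :=
  ∑ α : Fin 3, totalSpin Λ α * totalSpin Λ α

/-- `ψ` has total spin `S`: it satisfies `(S_tot)² ψ = S (S + 1) ψ`. -/
def HasTotalSpin (ψ : ElectronSpace Λ) (S : ℝ) : Prop :=
  totalSpinSq Λ ψ = ((S * (S + 1) : ℝ) : ℂ) • ψ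

/-- `ε` is the ground state energy of `H` for `N` electrons: the least energy eigenvalue in the
`N`-electron space. -/
def IsGroundEnergy (H : Module.End ℂ (ElectronSpace Λ)) (N : ℕ) (ε : ℝ) : Prop :=
  IsLeast {η : ℝ | ∃ ψ ∈ sector Λ N, ψ ≠ 0 ∧ H ψ = (η : ℂ) • ψ} ε

/-- The `N`-electron eigenvectors of `H` with energy `ε`, together with `0`. For the ground state
energy `ε` the nonzero elements are the ground states. -/
def energySpace (H : Module.End ℂ (ElectronSpace Λ)) (N : ℕ) (ε : ℝ) :
    Submodule ℂ (ElectronSpace Λ) :=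
  sector Λ N ⊓ Module.End.eigenspace H (ε : ℂ)

end Electrons

/-! The Hubbard model on the lattice -/

namespace CellLattice

variable {n m : ℕ} {J E : Type*} [Fintype J] [DecidableEq J] [Fintype E] [DecidableEq E]
  (L : CellLattice n m J E)

/-- `b_{j,σ} = c_{u_j,σ} + c_{v_j,σ} + ν ∑_{x ∈ C_j ∩ E} c_{x,σ}`. -/
def b (ν : ℝ) (j : J) (σ : Spin) : Module.End ℂ (ElectronSpace (Site J E)) :=
  c (siteU j) σ + c (siteV j) σ + (ν : ℂ) • ∑ i : Fin n, c (siteX (L.ext j i)) σ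

/-- `d_{j,σ} = c_{u_j,σ} - c_{v_j,σ}`. -/
def d (_L : CellLattice n m J E) (j : J) (σ : Spin) :
    Module.End ℂ (ElectronSpace (Site J E)) :=
  c (siteU j) σ - c (siteV j) σ

/-- The Hamiltonian
`H = t ∑_{j,σ} b†_{j,σ} b_{j,σ} + s' ∑_{j,σ} d†_{j,σ} d_{j,σ} + U ∑_r n_{r,↑} n_{r,↓}`. -/
def hamiltonian (ν t s' U : ℝ) : Module.End ℂ (ElectronSpace (Site J E)) :=
  (t : ℂ) • ∑ j : J, ∑ σ : Spin, LinearMap.adjoint (L.b ν j σ) * L.b ν j σ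
    + (s' : ℂ) • ∑ j : J, ∑ σ : Spin, LinearMap.adjoint (L.d j σ) * L.d j σ
    + (U : ℂ) • ∑ r : Site J E, num r 0 * num r 1

end CellLattice

end

end FlatBand

/-!
The three terms of the Hamiltonian are sums of squares `T† T` with positive coefficients, the
operators `T` being `b_{j,σ}`, `d_{j,σ}` and `c_{r,↓} c_{r,↑}`. Hence no energy is negative, and a
state has energy zero if and only if all these operators annihilate it
(`mem_energySpace_zero_iff`). The flat band, i.e. the one-electron zero modes of the hopping, is
spanned by one localized state per external site, so it is half filled for `N_e = |E|`; the Slater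
determinant `slater` of the localized states with parallel spins (along the first axis) has energy
zero, because `c_{r,↑}` and `c_{r,↓}` agree on it. So zero is the ground state energy.

Let `ψ` have energy zero. In the flat band the removal of an electron from an internal site can be
replaced by removals from external sites, so `ψ` is determined by its amplitudes on configurations
of the external sites (`eq_zero_of_external`). As there are as many electrons as external sites and
double occupancy is excluded, only the spin configurations with one electron on each external site
contribute. The exclusion of double occupancy of `u_j` then says that `ψ` is symmetric under the
exchange of the spins of any two external sites of the cell `j`
(`exchangeSymmetric_of_same_cell`), and by connectedness the symmetry extends to all pairs of
sites (`exchangeSymmetric_trans`, `isSpinSymmetric`). This has two consequences.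

* Spin exchange acts trivially on `ψ`, so that `(S_tot)²` depends only on the number of electrons
  (`IsSpinSymmetric.hasTotalSpin`).
* The vanishing of an amplitude depends only on the number of down spins, so that the ground states
  form a space of dimension at most `N_e + 1`. The projections of `slater` to the possible numbers
  of down spins are nonzero ground states, so the dimension is exactly `N_e + 1`
  (`finrank_energySpace`).
-/

namespace FlatBand

/-! ### Canonical anticommutation relations -/

section Fock

variable {κ : Type*} [Fintype κ]

lemma jwSign_mul_self (k : κ) (A : Finset κ) : jwSign k A * jwSign k A = 1 := by
  rw [jwSign, ← mul_pow]
  simp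

lemma jwSign_ne_zero (k : κ) (A : Finset κ) : jwSign k A ≠ 0 := by
  simp [jwSign]

lemma star_jwSign (k : κ) (A : Finset κ) : star (jwSign k A) = jwSign k A := by
  simp [jwSign]

variable [DecidableEq κ]

lemma annihilate_apply (k : κ) (ψ : Fock κ) (A : Finset κ) :
    annihilate k ψ A = if k ∈ A then 0 else jwSign k A * ψ (insert k A) := rfl

lemma jwSign_insert (k : κ) {l : κ} {A : Finset κ} (h : l ∉ A) :
    jwSign k (insert l A)
      = (if Fintype.equivFin κ l < Fintype.equivFin κ k then -1 else 1) * jwSign k A := by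
  unfold jwSign
  rw [Finset.filter_insert]
  split_ifs with h1
  · rw [Finset.card_insert_of_notMem (by simp [h]), pow_succ]
    ring
  · simp

/-- The sign that makes operators of different modes anticommute. -/
lemma jwSign_mul_swap {k l : κ} (hkl : k ≠ l) {A : Finset κ} (hk : k ∉ A) (hl : l ∉ A) :
    jwSign k (insert l A) * jwSign l (insert k A) = -(jwSign k A * jwSign l A) := by
  rw [jwSign_insert k hl, jwSign_insert l hk]
  have hne : Fintype.equivFin κ k ≠ Fintype.equivFin κ l := by simpa using hkl
  rcases lt_or_gt_of_ne hne with h | h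
  · simp [h, not_lt.mpr h.le]
  · simp [h, not_lt.mpr h.le]

lemma adjoint_annihilate_apply (k : κ) (ψ : Fock κ) (A : Finset κ) :
    LinearMap.adjoint (annihilate k) ψ A
      = if k ∈ A then jwSign k (A.erase k) * ψ (A.erase k) else 0 := by
  have h1 : LinearMap.adjoint (annihilate k) ψ A
      = inner ℂ (EuclideanSpace.single A (1 : ℂ)) (LinearMap.adjoint (annihilate k) ψ) := by
    simp [EuclideanSpace.inner_single_left]
  have h2 : annihilate k (EuclideanSpace.single A (1 : ℂ))
      = if k ∈ A then EuclideanSpace.single (A.erase k) (jwSign k (A.erase k)) else 0 := by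
    ext B
    rw [annihilate_apply]
    by_cases hk : k ∈ A
    · by_cases hB : k ∈ B
      · have : B ≠ A.erase k := by rintro rfl; simp at hB
        simp [hk, hB, this]
      · by_cases hBA : B = A.erase k
        · subst hBA
          simp [hk, Finset.insert_erase hk]
        · have : insert k B ≠ A := by
            rintro rfl; exact hBA (by simp [hB])
          simp [hk, hB, hBA, this]
    · have : insert k B ≠ A := by rintro rfl; simp at hk
      simp [hk, this]
  rw [h1, LinearMap.adjoint_inner_right, h2]
  split_ifs
  · rw [EuclideanSpace.inner_single_left]
    congr 1
    exact star_jwSign _ _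
  · simp

lemma annihilate_anticomm (k l : κ) (ψ : Fock κ) :
    annihilate k (annihilate l ψ) = -annihilate l (annihilate k ψ) := by
  ext A
  simp only [annihilate_apply, PiLp.neg_apply]
  by_cases hkl : k = l
  · subst hkl
    by_cases hk : k ∈ A <;> simp [hk]
  by_cases hk : k ∈ A
  · simp [hk]
  by_cases hl : l ∈ A
  · simp [hl]
  have hlk : l ≠ k := fun h => hkl h.symm
  simp only [hk, hl, Finset.mem_insert, hkl, hlk, or_self, if_false, Finset.insert_comm l k A]
  rw [← mul_assoc, ← mul_assoc, ← neg_mul]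
  congr 1
  have h1 := jwSign_mul_swap hkl hk hl
  have h2 := jwSign_mul_self k A
  have h4 := jwSign_mul_self k (insert l A)
  linear_combination (jwSign k (insert l A) * jwSign k A) * h1 -
    jwSign l A * jwSign k (insert l A) * h2 - (jwSign k A * jwSign l (insert k A)) * h4

lemma annihilate_annihilate (k : κ) (ψ : Fock κ) : annihilate k (annihilate k ψ) = 0 := by
  ext A
  by_cases hk : k ∈ A <;> simp [annihilate_apply, hk]

lemma annihilate_adjoint_annihilate (k l : κ) (ψ : Fock κ) :
    annihilate k (LinearMap.adjoint (annihilate l) ψ)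
      = (if k = l then ψ else 0) - LinearMap.adjoint (annihilate l) (annihilate k ψ) := by
  ext A
  rw [PiLp.sub_apply, annihilate_apply, adjoint_annihilate_apply, adjoint_annihilate_apply,
    annihilate_apply]
  by_cases hkl : k = l
  · subst hkl
    by_cases hk : k ∈ A
    · simp [hk, ← mul_assoc, jwSign_mul_self]
    · simp [hk, ← mul_assoc, jwSign_mul_self]
  have hlk : l ≠ k := fun h => hkl h.symm
  by_cases hk : k ∈ A
  · simp [hk, hkl]
  by_cases hl : l ∈ A
  · obtain ⟨B, hB, rfl⟩ : ∃ B, l ∉ B ∧ A = insert l B :=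
      ⟨A.erase l, by simp, (Finset.insert_erase hl).symm⟩
    have hkB : k ∉ B := fun h => hk (Finset.mem_insert_of_mem h)
    have h1 : (insert k (insert l B)).erase l = insert k B := by
      rw [Finset.insert_comm, Finset.erase_insert]
      simp [hlk, hB]
    have h2 := jwSign_mul_swap hkl hkB hB
    simp only [hk, hl, hkl, hkB, h1, Finset.erase_insert hB, Finset.mem_insert, if_true, if_false,
      or_true, PiLp.zero_apply]
    linear_combination ψ (insert k B) * h2
  · simp [hk, hl, hkl, hlk]

lemma adjoint_annihilate_mul_apply (k : κ) (ψ : Fock κ) (A : Finset κ) :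
    (LinearMap.adjoint (annihilate k) * annihilate k) ψ A = if k ∈ A then ψ A else 0 := by
  rw [Module.End.mul_apply, adjoint_annihilate_apply]
  split_ifs with h
  · rw [annihilate_apply, if_neg (by simp), ← mul_assoc, jwSign_mul_self, one_mul,
      Finset.insert_erase h]
  · rfl

/-- An amplitude of `ψ` vanishes if and only if it does after an occupied mode is emptied. -/
lemma annihilate_apply_eq_zero_iff {k : κ} {A : Finset κ} (h : k ∉ A) (ψ : Fock κ) :
    annihilate k ψ A = 0 ↔ ψ (insert k A) = 0 := by
  rw [annihilate_apply, if_neg h]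
  simp [jwSign_ne_zero]

/-- The operator `∑ k, g k • c_k`, which annihilates the one-particle state with wave function
`star g`. -/
noncomputable def annihilateWave (g : κ → ℂ) : Module.End ℂ (Fock κ) := ∑ k, g k • annihilate k

lemma adjoint_annihilateWave_apply (g : κ → ℂ) (ψ : Fock κ) :
    LinearMap.adjoint (annihilateWave g) ψ
      = ∑ k, star (g k) • LinearMap.adjoint (annihilate k) ψ := by
  simp only [annihilateWave, map_sum, LinearMap.sum_apply, map_smulₛₗ, LinearMap.smul_apply]
  rfl

lemma annihilate_adjoint_annihilateWave (k : κ) (g : κ → ℂ) (ψ : Fock κ) :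
    annihilate k (LinearMap.adjoint (annihilateWave g) ψ)
      = star (g k) • ψ - LinearMap.adjoint (annihilateWave g) (annihilate k ψ) := by
  simp only [adjoint_annihilateWave_apply, map_sum, map_smul, annihilate_adjoint_annihilate,
    smul_sub, Finset.sum_sub_distrib]
  simp

/-- The vacuum: the basis state in which no mode is occupied. -/
noncomputable def vacuum (κ : Type*) [Fintype κ] [DecidableEq κ] : Fock κ :=
  EuclideanSpace.single ∅ 1

lemma vacuum_apply (A : Finset κ) : vacuum κ A = if A = ∅ then 1 else 0 := by
  simp [vacuum]

lemma annihilate_vacuum (k : κ) : annihilate k (vacuum κ) = 0 := by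
  ext A
  simp [annihilate_apply, vacuum_apply]

end Fock

/-! ### Electron number -/

section Electrons

variable {Λ : Type*} [Fintype Λ] [DecidableEq Λ]

lemma inner_adjoint_mul_self {κ : Type*} [Fintype κ] (T : Module.End ℂ (Fock κ)) (ψ : Fock κ) :
    inner ℂ ψ ((LinearMap.adjoint T * T) ψ) = ((‖T ψ‖ ^ 2 : ℝ) : ℂ) := by
  rw [Module.End.mul_apply, LinearMap.adjoint_inner_right, inner_self_eq_norm_sq_to_K]
  push_cast
  rfl

lemma num_apply (r : Λ) (σ : Spin) (ψ : ElectronSpace Λ) (A : Finset (Λ × Spin)) :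
    num r σ ψ A = if (r, σ) ∈ A then ψ A else 0 :=
  adjoint_annihilate_mul_apply _ _ _

lemma sum_num_apply (ψ : ElectronSpace Λ) (A : Finset (Λ × Spin)) :
    (∑ r : Λ, ∑ σ : Spin, num r σ) ψ A = (A.card : ℂ) * ψ A := by
  simp only [LinearMap.sum_apply, WithLp.ofLp_sum, Finset.sum_apply, num_apply]
  rw [← Fintype.sum_prod_type' (f := fun r σ => if (r, σ) ∈ A then ψ A else 0)]
  simp [Finset.sum_ite_mem]

lemma mem_sector_iff {N : ℕ} {ψ : ElectronSpace Λ} :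
    ψ ∈ sector Λ N ↔ ∀ A, A.card ≠ N → ψ A = 0 := by
  rw [sector, Module.End.mem_eigenspace_iff]
  constructor
  · intro h A hA
    have h1 := congrArg (fun φ : ElectronSpace Λ => φ A) h
    simp only [sum_num_apply, PiLp.smul_apply, smul_eq_mul] at h1
    have h2 : ((A.card : ℂ) - N) * ψ A = 0 := by linear_combination h1
    exact (mul_eq_zero.mp h2).resolve_left (sub_ne_zero.mpr (by exact_mod_cast hA))
  · intro h
    ext A
    rw [sum_num_apply, PiLp.smul_apply, smul_eq_mul]
    by_cases hA : A.card = N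
    · rw [hA]
    · simp [h A hA]

lemma c_anticomm (r s : Λ) (σ τ : Spin) (ψ : ElectronSpace Λ) :
    c r σ (c s τ ψ) = -c s τ (c r σ ψ) := annihilate_anticomm _ _ _

lemma c_adjoint_c (r s : Λ) (σ τ : Spin) (ψ : ElectronSpace Λ) :
    c r σ (LinearMap.adjoint (c s τ) ψ)
      = (if r = s ∧ σ = τ then ψ else 0) - LinearMap.adjoint (c s τ) (c r σ ψ) := by
  rw [c, c, annihilate_adjoint_annihilate]
  simp only [Prod.mk.injEq]

lemma num_mul_num (r : Λ) :
    num r 0 * num r 1 = LinearMap.adjoint (c r 1 * c r 0) * (c r 1 * c r 0) := by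
  ext1 ψ
  have h : LinearMap.adjoint (c r 1 * c r 0)
      = LinearMap.adjoint (c r 0) * LinearMap.adjoint (c r 1) := LinearMap.adjoint_comp _ _
  rw [h]
  simp only [num, Module.End.mul_apply, c_adjoint_c]
  simp [c_anticomm r r 0 1]

/-! ### Total spin -/

variable (Λ) in
/-- The bilinear form `∑ r, c†_{r,σ} c_{r,τ}`: a spin ladder operator for `σ ≠ τ`, and the number
of electrons of spin `σ` for `σ = τ`. -/
noncomputable def spinBilinear (σ τ : Spin) : Module.End ℂ (ElectronSpace Λ) :=
  ∑ r : Λ, LinearMap.adjoint (c r σ) * c r τ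

lemma spinBilinear_apply (σ τ : Spin) (ψ : ElectronSpace Λ) :
    spinBilinear Λ σ τ ψ = ∑ r : Λ, LinearMap.adjoint (c r σ) (c r τ ψ) := by
  simp [spinBilinear]

lemma totalSpin_eq (α : Fin 3) :
    totalSpin Λ α = (1 / 2 : ℂ) • (pauli α 0 0 • spinBilinear Λ 0 0
      + pauli α 0 1 • spinBilinear Λ 0 1 + pauli α 1 0 • spinBilinear Λ 1 0
      + pauli α 1 1 • spinBilinear Λ 1 1) := by
  simp only [totalSpin, spinBilinear, Fin.sum_univ_two, Finset.sum_add_distrib, Finset.smul_sum]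
  congr 1
  abel

lemma totalSpinSq_eq :
    totalSpinSq Λ = (1 / 2 : ℂ) • (spinBilinear Λ 0 1 * spinBilinear Λ 1 0
        + spinBilinear Λ 1 0 * spinBilinear Λ 0 1)
      + (1 / 4 : ℂ) • ((spinBilinear Λ 0 0 - spinBilinear Λ 1 1)
        * (spinBilinear Λ 0 0 - spinBilinear Λ 1 1)) := by
  simp only [totalSpinSq, Fin.sum_univ_three, totalSpin_eq]
  simp only [pauli, Matrix.cons_val, Matrix.of_apply, Matrix.cons_val', Matrix.cons_val_zero,
    Matrix.cons_val_one, zero_smul, one_smul, zero_add, add_zero, neg_smul, ← sub_eq_add_neg,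
    smul_mul_smul_comm, mul_add, add_mul, mul_sub, sub_mul, mul_zero,
    zero_mul, Complex.I_mul_I]
  module

/-- The spins of electrons at `r` and `s` can be exchanged in `ψ`. -/
def ExchangeSymmetric (ψ : ElectronSpace Λ) (r s : Λ) : Prop :=
  c r 0 (c s 1 ψ) = c r 1 (c s 0 ψ)

lemma ExchangeSymmetric.swap {ψ : ElectronSpace Λ} {r s : Λ} (h : ExchangeSymmetric ψ r s)
    (σ τ : Spin) : c r σ (c s τ ψ) = c r τ (c s σ ψ) := by
  fin_cases σ <;> fin_cases τ
  · rfl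
  · exact h
  · exact h.symm
  · rfl

/-- The two-electron amplitudes of `ψ` are symmetric under exchange of the spins. -/
def IsSpinSymmetric (ψ : ElectronSpace Λ) : Prop := ∀ r s, ExchangeSymmetric ψ r s

lemma IsSpinSymmetric.spinBilinear_swap {ψ : ElectronSpace Λ} (h : IsSpinSymmetric ψ)
    {σ τ : Spin} (hστ : σ ≠ τ) :
    spinBilinear Λ σ τ (spinBilinear Λ τ σ ψ)
      = spinBilinear Λ σ σ ψ + spinBilinear Λ σ σ (spinBilinear Λ τ τ ψ) := by
  have key (r : Λ) : c r τ (spinBilinear Λ τ σ ψ)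
      = c r σ ψ + c r σ (spinBilinear Λ τ τ ψ) := by
    simp only [spinBilinear_apply, map_sum, c_adjoint_c, hστ, and_false, and_true, if_false,
      Finset.sum_neg_distrib, (h _ _).swap τ σ, sub_eq_add_neg,
      zero_add, Finset.sum_add_distrib]
    simp
  rw [spinBilinear_apply σ τ, spinBilinear_apply σ σ, spinBilinear_apply σ σ,
    ← Finset.sum_add_distrib]
  exact Finset.sum_congr rfl fun r _ => by rw [key, map_add]

/-- A state with spin-symmetric two-electron amplitudes has the maximal total spin: on it the spin
exchange in each term `S_r · S_s` acts trivially. -/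
lemma IsSpinSymmetric.hasTotalSpin {ψ : ElectronSpace Λ} (h : IsSpinSymmetric ψ) {N : ℕ}
    (hψ : ψ ∈ sector Λ N) : HasTotalSpin ψ ((N : ℝ) / 2) := by
  have hN (φ : ElectronSpace Λ) (hφ : φ ∈ sector Λ N) :
      spinBilinear Λ 0 0 φ + spinBilinear Λ 1 1 φ = (N : ℂ) • φ := by
    rw [sector, Module.End.mem_eigenspace_iff] at hφ
    rw [← hφ]
    simp [spinBilinear, num, Fin.sum_univ_two, Finset.sum_add_distrib]
  have h1 := hN ψ hψ
  have h2 := hN _ ((sector Λ N).smul_mem (N : ℂ) hψ)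
  nth_rewrite 1 2 [← h1] at h2
  have h3 := h.spinBilinear_swap (σ := 0) (τ := 1) (by decide)
  have h4 := h.spinBilinear_swap (σ := 1) (τ := 0) (by decide)
  rw [HasTotalSpin, totalSpinSq_eq]
  simp only [LinearMap.add_apply, LinearMap.smul_apply, Module.End.mul_apply,
    LinearMap.sub_apply, map_sub, h3, h4]
  simp only [map_add] at h2
  push_cast
  linear_combination (norm := module) (1 / 2 : ℂ) • h1 + (1 / 4 : ℂ) • h2

end Electrons

/-! ### States without double occupancy -/

section NoDouble

variable {Λ : Type*} [Fintype Λ] [DecidableEq Λ]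

/-- No site is occupied by two electrons in `ψ`. -/
def NoDoubleOccupancy (ψ : ElectronSpace Λ) : Prop := ∀ r, c r 1 (c r 0 ψ) = 0

lemma NoDoubleOccupancy.c {ψ : ElectronSpace Λ} (h : NoDoubleOccupancy ψ) (r : Λ) (σ : Spin) :
    NoDoubleOccupancy (c r σ ψ) := fun s => by
  rw [c_anticomm s r 0 σ, map_neg, c_anticomm s r 1 σ, h s]
  simp

lemma c_apply_eq_zero_iff {r : Λ} {σ : Spin} {A : Finset (Λ × Spin)} (h : (r, σ) ∉ A)
    (ψ : ElectronSpace Λ) : c r σ ψ A = 0 ↔ ψ (insert (r, σ) A) = 0 :=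
  annihilate_apply_eq_zero_iff h ψ

lemma c_apply_of_mem {r : Λ} {σ : Spin} {A : Finset (Λ × Spin)} (h : (r, σ) ∈ A)
    (ψ : ElectronSpace Λ) : c r σ ψ A = 0 := if_pos h

lemma NoDoubleOccupancy.apply_eq_zero {ψ : ElectronSpace Λ} (h : NoDoubleOccupancy ψ) {r : Λ}
    {A : Finset (Λ × Spin)} (h0 : (r, 0) ∈ A) (h1 : (r, 1) ∈ A) : ψ A = 0 := by
  have h2 : ((r, 1) : Λ × Spin) ∈ A.erase (r, 0) := by simp [h1]
  have h3 := congrArg (fun φ : ElectronSpace Λ => φ ((A.erase (r, 0)).erase (r, 1))) (h r)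
  simp only [PiLp.zero_apply] at h3
  rwa [c_apply_eq_zero_iff (by simp), Finset.insert_erase h2, c_apply_eq_zero_iff (by simp),
    Finset.insert_erase h0] at h3

lemma NoDoubleOccupancy.c_apply_eq_zero {ψ : ElectronSpace Λ} (h : NoDoubleOccupancy ψ) {r : Λ}
    {τ : Spin} {A : Finset (Λ × Spin)} (hA : (r, τ) ∈ A) (σ : Spin) : FlatBand.c r σ ψ A = 0 := by
  by_cases hσ : (r, σ) ∈ A
  · exact c_apply_of_mem hσ ψ
  · rw [c_apply_eq_zero_iff hσ]
    have hne : σ ≠ τ := by rintro rfl; exact hσ hA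
    have h1 : ((r, σ) : Λ × Spin) ∈ insert (r, σ) A := Finset.mem_insert_self _ _
    have h2 : ((r, τ) : Λ × Spin) ∈ insert (r, σ) A := Finset.mem_insert_of_mem hA
    match σ, τ with
    | 0, 0 => exact absurd rfl hne
    | 0, 1 => exact h.apply_eq_zero h1 h2
    | 1, 0 => exact h.apply_eq_zero h2 h1
    | 1, 1 => exact absurd rfl hne

/-! ### Exchange symmetry of a pair of sites -/

lemma NoDoubleOccupancy.exchangeSymmetric_self {ψ : ElectronSpace Λ} (h : NoDoubleOccupancy ψ)
    (r : Λ) : ExchangeSymmetric ψ r r := by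
  rw [ExchangeSymmetric, c_anticomm, h r, neg_zero]

lemma ExchangeSymmetric.symm {ψ : ElectronSpace Λ} {r s : Λ} (h : ExchangeSymmetric ψ r s) :
    ExchangeSymmetric ψ s r := by
  rw [ExchangeSymmetric, c_anticomm, ← h.swap, ← c_anticomm]

/-- Two exchanges through a middle site `s` that carries an electron make up an exchange of the
outer sites. -/
lemma ExchangeSymmetric.c_trans {ψ : ElectronSpace Λ} {q r s : Λ} (hqs : ExchangeSymmetric ψ q s)
    (hsr : ExchangeSymmetric ψ s r) (τ : Spin) :
    c s τ (c q 0 (c r 1 ψ)) = c s τ (c q 1 (c r 0 ψ)) := by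
  have key (σ ρ : Spin) : c s σ (c q σ (c r ρ ψ)) = c s σ (c q ρ (c r σ ψ)) := by
    rw [c_anticomm s q σ σ, hsr.swap σ ρ, c_anticomm s r ρ σ, map_neg, neg_neg,
      c_anticomm q r, hqs.swap σ ρ, ← c_anticomm q r, c_anticomm s q σ ρ, c_anticomm s r σ σ,
      map_neg, neg_neg]
  match τ with
  | 0 => exact key 0 1
  | 1 => exact (key 1 0).symm

end NoDouble

namespace CellLattice

/-! ### Spin configurations on the external sites -/

section SpinConfig

variable {J E : Type*} [DecidableEq J] [Fintype E] [DecidableEq E]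

/-- The configuration with one electron on each external site, of spin down on `D` and of spin up
elsewhere. -/
def spinConfig (J : Type*) [DecidableEq J] (D : Finset E) : Finset (Site J E × Spin) :=
  Finset.univ.image fun x => (siteX x, if x ∈ D then 1 else 0)

lemma mem_spinConfig {D : Finset E} {k : Site J E × Spin} :
    k ∈ spinConfig J D ↔ ∃ x, k = (siteX x, if x ∈ D then 1 else 0) := by
  simp [spinConfig, eq_comm]

lemma spinConfig_insert_erase (D : Finset E) (x : E) (σ : Spin) :
    insert (siteX x, σ) ((spinConfig J D).filter fun k => k.1 ≠ siteX x)
      = spinConfig J (if σ = 0 then D.erase x else insert x D) := by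
  ext ⟨r, τ⟩
  simp only [Finset.mem_insert, Finset.mem_filter, mem_spinConfig, Prod.mk.injEq]
  constructor
  · rintro (⟨rfl, rfl⟩ | ⟨⟨y, rfl, rfl⟩, hy⟩)
    · refine ⟨x, rfl, ?_⟩
      match τ with
      | 0 => simp
      | 1 => simp
    · refine ⟨y, rfl, ?_⟩
      have : y ≠ x := fun h => hy (h ▸ rfl)
      split_ifs <;> simp_all
  · rintro ⟨y, rfl, hy⟩
    by_cases hyx : y = x
    · subst hyx
      left
      refine ⟨rfl, hy.trans ?_⟩
      match σ with
      | 0 => simp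
      | 1 => simp
    · right
      refine ⟨⟨y, rfl, hy.trans ?_⟩, by simpa using hyx⟩
      split_ifs <;> simp_all

end SpinConfig

/-! ### Zero modes of the hopping terms -/

variable {n m : ℕ} {J E : Type*} [Fintype J] [DecidableEq J] [Fintype E] [DecidableEq E]
  (L : CellLattice n m J E)

/-- The states annihilated by all `b_{j,σ}` and `d_{j,σ}`, i.e. those in which all electrons are in
the flat band. -/
noncomputable def flatSpace (ν : ℝ) : Submodule ℂ (ElectronSpace (Site J E)) :=
  ⨅ (j : J) (σ : Spin), LinearMap.ker (L.b ν j σ) ⊓ LinearMap.ker (L.d j σ)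

variable {L} {ν : ℝ}

lemma mem_flatSpace_iff {ψ : ElectronSpace (Site J E)} :
    ψ ∈ L.flatSpace ν ↔ ∀ j σ, L.b ν j σ ψ = 0 ∧ L.d j σ ψ = 0 := by
  simp [flatSpace]

lemma b_apply (j : J) (σ : Spin) (ψ : ElectronSpace (Site J E)) :
    L.b ν j σ ψ = c (siteU j) σ ψ + c (siteV j) σ ψ
      + (ν : ℂ) • ∑ i : Fin n, c (siteX (L.ext j i)) σ ψ := by
  simp [b]

lemma d_apply (j : J) (σ : Spin) (ψ : ElectronSpace (Site J E)) :
    L.d j σ ψ = c (siteU j) σ ψ - c (siteV j) σ ψ := rfl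

lemma c_mem_flatSpace {ψ : ElectronSpace (Site J E)} (h : ψ ∈ L.flatSpace ν) (r : Site J E)
    (τ : Spin) : c r τ ψ ∈ L.flatSpace ν := by
  rw [mem_flatSpace_iff] at h ⊢
  intro j σ
  have hb : L.b ν j σ (c r τ ψ) = -c r τ (L.b ν j σ ψ) := by
    simp only [b_apply, c_anticomm _ r σ τ, map_add, map_smul, map_sum, Finset.sum_neg_distrib,
      smul_neg, neg_add]
  have hd : L.d j σ (c r τ ψ) = -c r τ (L.d j σ ψ) := by
    simp only [d_apply, c_anticomm _ r σ τ, map_sub]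
    abel
  rw [hb, hd, (h j σ).1, (h j σ).2]
  simp

/-- In the flat band, removing an electron from an internal site amounts to removing it from
external sites. -/
lemma c_internal_eq {ψ : ElectronSpace (Site J E)} (h : ψ ∈ L.flatSpace ν) (j : J ⊕ J)
    (σ : Spin) : c (Sum.inl j) σ ψ = (-(ν : ℂ) / 2) •
      ∑ i : Fin n, c (siteX (L.ext (j.elim id id) i)) σ ψ := by
  rw [mem_flatSpace_iff] at h
  have h1 := (h (j.elim id id) σ).1
  have h2 := (h (j.elim id id) σ).2
  rw [b_apply] at h1
  rw [d_apply] at h2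
  rcases j with j | j
  · simp only [Sum.elim_inl, id] at *
    linear_combination (norm := module) (1 / 2 : ℂ) • h1 + (1 / 2 : ℂ) • h2
  · simp only [Sum.elim_inr, id] at *
    linear_combination (norm := module) (1 / 2 : ℂ) • h1 - (1 / 2 : ℂ) • h2

/-- A flat-band state is determined by its amplitudes on the configurations of external sites. -/
lemma eq_zero_of_external {ψ : ElectronSpace (Site J E)} (h : ψ ∈ L.flatSpace ν)
    (h0 : ∀ A : Finset (Site J E × Spin), (∀ k ∈ A, k.1.isRight) → ψ A = 0) : ψ = 0 := by
  ext A
  rw [PiLp.zero_apply]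
  induction A using Finset.induction_on generalizing ψ with
  | empty => exact h0 ∅ (by simp)
  | insert k A hk ih =>
    obtain ⟨r, σ⟩ := k
    rw [← c_apply_eq_zero_iff hk]
    have hX (x : E) (B : Finset (Site J E × Spin)) (hB : ∀ k ∈ B, k.1.isRight) :
        c (siteX x) σ ψ B = 0 := by
      by_cases hx : (siteX x, σ) ∈ B
      · exact c_apply_of_mem hx ψ
      · rw [c_apply_eq_zero_iff hx]
        exact h0 _ (by simpa using hB)
    refine ih (c_mem_flatSpace h r σ) fun B hB => ?_
    rcases r with j | x
    · rw [c_internal_eq h]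
      simp [hX _ B hB]
    · exact hX x B hB

/-! ### Half filling of the flat band -/

lemma image_fst_eq {ψ : ElectronSpace (Site J E)} (hN : ψ ∈ sector _ (Fintype.card E))
    (hD : NoDoubleOccupancy ψ) {A : Finset (Site J E × Spin)} (hA : ∀ k ∈ A, k.1.isRight)
    (h0 : ψ A ≠ 0) : A.image Prod.fst = Finset.univ.map ⟨siteX, Sum.inr_injective⟩ := by
  have hcard : A.card = Fintype.card E := by
    by_contra h
    exact h0 (mem_sector_iff.mp hN A h)
  have hinj : Set.InjOn Prod.fst (A : Set (Site J E × Spin)) := by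
    rintro ⟨r, σ⟩ h1 ⟨s, τ⟩ h2 (rfl : r = s)
    by_contra hne
    refine h0 ?_
    match σ, τ with
    | 0, 0 => exact absurd rfl hne
    | 0, 1 => exact hD.apply_eq_zero h1 h2
    | 1, 0 => exact hD.apply_eq_zero h2 h1
    | 1, 1 => exact absurd rfl hne
  refine Finset.eq_of_subset_of_card_le ?_ ?_
  · intro r hr
    obtain ⟨k, hk, rfl⟩ := Finset.mem_image.mp hr
    obtain ⟨x, hx⟩ := Sum.isRight_iff.mp (hA k hk)
    simp [hx]
  · rw [Finset.card_image_of_injOn hinj, hcard, Finset.card_map, Finset.card_univ]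

lemma exists_mem_of_apply_ne_zero {ψ : ElectronSpace (Site J E)}
    (hN : ψ ∈ sector _ (Fintype.card E)) (hD : NoDoubleOccupancy ψ)
    {A : Finset (Site J E × Spin)} (hA : ∀ k ∈ A, k.1.isRight) (h0 : ψ A ≠ 0) (x : E) :
    ∃ τ, (siteX x, τ) ∈ A := by
  have h1 : siteX x ∈ A.image Prod.fst := by
    rw [image_fst_eq hN hD hA h0]
    simp
  obtain ⟨⟨r, τ⟩, h2, rfl⟩ := Finset.mem_image.mp h1
  exact ⟨τ, h2⟩

/-- Removing electrons from `x` and `y` leaves all other external sites occupied. -/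
lemma exists_mem_of_c_c_apply_ne_zero {ψ : ElectronSpace (Site J E)}
    (hN : ψ ∈ sector _ (Fintype.card E)) (hD : NoDoubleOccupancy ψ) {x y : E} {σ τ : Spin}
    {A : Finset (Site J E × Spin)} (hA : ∀ k ∈ A, k.1.isRight)
    (h0 : c (siteX x) σ (c (siteX y) τ ψ) A ≠ 0) {z : E} (hzx : z ≠ x) (hzy : z ≠ y) :
    ∃ ρ, (siteX z, ρ) ∈ A := by
  have hx : (siteX x, σ) ∉ A := fun h => h0 (c_apply_of_mem h _)
  rw [Ne, c_apply_eq_zero_iff hx] at h0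
  have hy : (siteX y, τ) ∉ insert (siteX x, σ) A := fun h => h0 (c_apply_of_mem h _)
  rw [c_apply_eq_zero_iff hy] at h0
  obtain ⟨ρ, hρ⟩ := exists_mem_of_apply_ne_zero hN hD (by simpa using hA) h0 z
  exact ⟨ρ, by simpa [hzx, hzy] using hρ⟩

lemma exchangeSymmetric_of_apply {ψ : ElectronSpace (Site J E)} (hF : ψ ∈ L.flatSpace ν)
    (hN : ψ ∈ sector _ (Fintype.card E)) (hD : NoDoubleOccupancy ψ) {x y : E}
    (h : ∀ A : Finset (Site J E × Spin), (∀ k ∈ A, k.1.isRight) →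
      (∀ τ, (siteX x, τ) ∉ A) → (∀ τ, (siteX y, τ) ∉ A) →
      (∀ z, z ≠ x → z ≠ y → ∃ τ, (siteX z, τ) ∈ A) →
      c (siteX x) 0 (c (siteX y) 1 ψ) A = c (siteX x) 1 (c (siteX y) 0 ψ) A) :
    ExchangeSymmetric ψ (siteX x) (siteX y) := by
  rw [ExchangeSymmetric, ← sub_eq_zero]
  refine eq_zero_of_external (L := L) (ν := ν) (Submodule.sub_mem _
    (c_mem_flatSpace (c_mem_flatSpace hF _ _) _ _)
    (c_mem_flatSpace (c_mem_flatSpace hF _ _) _ _)) fun A hA => ?_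
  rw [PiLp.sub_apply, sub_eq_zero]
  by_contra hne
  have hx (τ) : (siteX x, τ) ∉ A := fun hx => hne <| by
    rw [(hD.c _ _).c_apply_eq_zero hx, (hD.c _ _).c_apply_eq_zero hx]
  have hy (τ) : (siteX y, τ) ∉ A := fun hy => hne <| by
    rw [c_anticomm (siteX x) (siteX y), c_anticomm (siteX x) (siteX y) 1,
      PiLp.neg_apply, PiLp.neg_apply,
      (hD.c _ _).c_apply_eq_zero hy, (hD.c _ _).c_apply_eq_zero hy]
  refine hne (h A hA hx hy fun z hzx hzy => ?_)
  by_cases h1 : c (siteX x) 0 (c (siteX y) 1 ψ) A = 0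
  · exact exists_mem_of_c_c_apply_ne_zero (σ := 1) (τ := 0) hN hD hA
      (fun h2 => hne (h1.trans h2.symm)) hzx hzy
  · exact exists_mem_of_c_c_apply_ne_zero hN hD hA h1 hzx hzy

/-- Excluding double occupancy of the internal site `u_j` makes the spins of the external sites of
the cell `j` exchangeable. -/
lemma exchangeSymmetric_of_same_cell (hν : ν ≠ 0) {ψ : ElectronSpace (Site J E)}
    (hF : ψ ∈ L.flatSpace ν) (hN : ψ ∈ sector _ (Fintype.card E)) (hD : NoDoubleOccupancy ψ)
    (j : J) (i i' : Fin n) :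
    ExchangeSymmetric ψ (siteX (L.ext j i)) (siteX (L.ext j i')) := by
  rcases eq_or_ne i i' with rfl | hi
  · exact hD.exchangeSymmetric_self _
  refine exchangeSymmetric_of_apply hF hN hD fun A hA hx hy hz => ?_
  have h1 : ∑ k : Fin n, ∑ l : Fin n,
      c (siteX (L.ext j k)) 1 (c (siteX (L.ext j l)) 0 ψ) = 0 := by
    have h2 := hD (siteU j)
    rw [c_internal_eq (c_mem_flatSpace hF _ _), c_internal_eq hF] at h2
    simpa [map_sum, ← Finset.smul_sum, hν] using h2
  have h3 := congrArg (fun φ : ElectronSpace (Site J E) => φ A) h1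
  simp only [WithLp.ofLp_sum, Finset.sum_apply, PiLp.zero_apply] at h3
  have hne (k l : Fin n) (hk : ¬ (k = i ∧ l = i' ∨ k = i' ∧ l = i)) :
      c (siteX (L.ext j k)) 1 (c (siteX (L.ext j l)) 0 ψ) A = 0 := by
    have inj {a b : Fin n} : L.ext j a ≠ L.ext j b ↔ a ≠ b := (L.ext_injective j).ne_iff
    by_cases hk1 : k = i ∨ k = i'
    · by_cases hl1 : l = i ∨ l = i'
      · have : k = l := by grind
        rw [this, hD]
        rfl
      · obtain ⟨τ, hτ⟩ := hz (L.ext j l) (inj.mpr (by tauto)) (inj.mpr (by tauto))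
        rw [c_anticomm, PiLp.neg_apply, (hD.c _ _).c_apply_eq_zero hτ, neg_zero]
    · obtain ⟨τ, hτ⟩ := hz (L.ext j k) (inj.mpr (by tauto)) (inj.mpr (by tauto))
      exact (hD.c _ _).c_apply_eq_zero hτ _
  rw [← Fintype.sum_prod_type' (f := fun k l =>
      c (siteX (L.ext j k)) 1 (c (siteX (L.ext j l)) 0 ψ) A),
    ← Finset.sum_subset (Finset.subset_univ {(i, i'), (i', i)})
      (fun p _ hp => hne p.1 p.2 (by simpa [Prod.ext_iff] using hp)),
    Finset.sum_pair (by simp [hi])] at h3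
  dsimp only at h3
  rw [c_anticomm (siteX (L.ext j i')), PiLp.neg_apply] at h3
  linear_combination -h3

lemma exchangeSymmetric_trans {ψ : ElectronSpace (Site J E)}
    (hF : ψ ∈ L.flatSpace ν) (hN : ψ ∈ sector _ (Fintype.card E)) (hD : NoDoubleOccupancy ψ)
    {x y z : E} (hxy : ExchangeSymmetric ψ (siteX x) (siteX y))
    (hyz : ExchangeSymmetric ψ (siteX y) (siteX z)) :
    ExchangeSymmetric ψ (siteX x) (siteX z) := by
  rcases eq_or_ne y x with rfl | hyx
  · exact hyz
  rcases eq_or_ne y z with rfl | hyz'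
  · exact hxy
  refine exchangeSymmetric_of_apply hF hN hD fun A _ _ _ hA => ?_
  -- The site `y` is occupied in `A`, so both amplitudes are, up to the same sign, amplitudes after
  -- the removal of an electron at `y`.
  obtain ⟨τ, hτ⟩ := hA y hyx hyz'
  have h1 := hxy.c_trans hyz τ
  rw [← sub_eq_zero, ← map_sub] at h1
  have h2 := congrArg (fun φ : ElectronSpace (Site J E) => φ (A.erase (siteX y, τ))) h1
  simp only [PiLp.zero_apply] at h2
  rw [c_apply_eq_zero_iff (by simp), Finset.insert_erase hτ, PiLp.sub_apply, sub_eq_zero] at h2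
  exact h2

/-- Along the connected lattice the exchange symmetry spreads from cells to all pairs of external
sites. -/
lemma exchangeSymmetric_external (hL : L.graph.Connected) (hν : ν ≠ 0)
    {ψ : ElectronSpace (Site J E)} (hF : ψ ∈ L.flatSpace ν)
    (hN : ψ ∈ sector _ (Fintype.card E)) (hD : NoDoubleOccupancy ψ) (x y : E) :
    ExchangeSymmetric ψ (siteX x) (siteX y) := by
  let P : Site J E → Prop := Sum.elim
    (fun j => ∀ i, ExchangeSymmetric ψ (siteX x) (siteX (L.ext (j.elim id id) i)))
    (fun z => ExchangeSymmetric ψ (siteX x) (siteX z))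
  have hcell (r : Site J E) (j : J) (hr : r ∈ L.cell j) (hP : P r) (i : Fin n) :
      ExchangeSymmetric ψ (siteX x) (siteX (L.ext j i)) := by
    rcases hr with (rfl | rfl) | ⟨i', rfl⟩
    · exact hP i
    · exact hP i
    · exact exchangeSymmetric_trans hF hN hD hP (exchangeSymmetric_of_same_cell hν hF hN hD j i' i)
  have hadj (r s : Site J E) (hrs : L.graph.Adj r s) (hP : P r) : P s := by
    obtain ⟨-, j, hr, hs⟩ := hrs
    rcases hs with (rfl | rfl) | ⟨i', rfl⟩
    · exact hcell r j hr hP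
    · exact hcell r j hr hP
    · exact hcell r j hr hP i'
  have hwalk (r s : Site J E) (w : L.graph.Walk r s) (hP : P r) : P s := by
    induction w with
    | nil => exact hP
    | cons h _ ih => exact ih (hadj _ _ h hP)
  obtain ⟨w⟩ := hL.preconnected (siteX x) (siteX y)
  exact hwalk _ _ w (hD.exchangeSymmetric_self _)

lemma isSpinSymmetric (hL : L.graph.Connected) (hν : ν ≠ 0)
    {ψ : ElectronSpace (Site J E)} (hF : ψ ∈ L.flatSpace ν)
    (hN : ψ ∈ sector _ (Fintype.card E)) (hD : NoDoubleOccupancy ψ) : IsSpinSymmetric ψ := by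
  have hX (x : E) (s : Site J E) : c (siteX x) 0 (c s 1 ψ) = c (siteX x) 1 (c s 0 ψ) := by
    rcases s with j | y
    · simp only [c_internal_eq hF, map_smul, map_sum]
      congr 1
      exact Finset.sum_congr rfl fun i _ => exchangeSymmetric_external hL hν hF hN hD x _
    · exact exchangeSymmetric_external hL hν hF hN hD x y
  intro r s
  rcases r with j | x
  · rw [ExchangeSymmetric, c_internal_eq (c_mem_flatSpace hF _ _),
      c_internal_eq (c_mem_flatSpace hF _ _)]
    simp only [hX]
  · exact hX x s

/-! ### Amplitudes of spin configurations -/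

lemma eq_zero_of_spinConfig {ψ : ElectronSpace (Site J E)} (hF : ψ ∈ L.flatSpace ν)
    (hN : ψ ∈ sector _ (Fintype.card E)) (hD : NoDoubleOccupancy ψ)
    (h : ∀ D, ψ (spinConfig J D) = 0) : ψ = 0 := by
  refine eq_zero_of_external hF fun A hA => ?_
  by_contra h0
  have h1 : A = spinConfig J {x | (siteX x, 1) ∈ A} := by
    have hocc := exists_mem_of_apply_ne_zero hN hD hA h0
    ext ⟨r, σ⟩
    rw [mem_spinConfig]
    constructor
    · intro hr
      obtain ⟨x, rfl⟩ := Sum.isRight_iff.mp (hA _ hr)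
      refine ⟨x, ?_⟩
      match σ with
      | 0 =>
        have : (siteX x, 1) ∉ A := fun h1 => h0 (hD.apply_eq_zero hr h1)
        simp [this]
      | 1 => simp [hr]
    · rintro ⟨x, hx⟩
      rw [Prod.mk.injEq] at hx
      obtain ⟨rfl, rfl⟩ := hx
      obtain ⟨τ, hτ⟩ := hocc x
      by_cases h1 : (siteX x, 1) ∈ A
      · simp [h1]
      · match τ with
        | 0 => simpa [h1] using hτ
        | 1 => exact absurd hτ h1
  exact h0 (h1 ▸ h _)

/-- Moving a down spin from `x` to `y` preserves the vanishing of an amplitude. -/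
lemma spinConfig_move {ψ : ElectronSpace (Site J E)} (h : IsSpinSymmetric ψ) {D : Finset E}
    {x y : E} (hx : x ∈ D) (hy : y ∉ D) (h0 : ψ (spinConfig J D) = 0) :
    ψ (spinConfig J (insert y (D.erase x))) = 0 := by
  have hxy : x ≠ y := by rintro rfl; exact hy hx
  have hyx := hxy.symm
  set A := ((spinConfig J D).filter fun k => k.1 ≠ siteX x).filter fun k => k.1 ≠ siteX y with hA
  have key (σ τ : Spin) : c (siteX x) σ (c (siteX y) τ ψ) A = 0 ↔
      ψ (insert (siteX y, τ) (insert (siteX x, σ) A)) = 0 := by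
    rw [c_apply_eq_zero_iff (by simp [hA]), c_apply_eq_zero_iff (by simp [hA, hyx])]
  have key2 (σ τ : Spin) : insert (siteX y, τ) (insert (siteX x, σ) A) =
      spinConfig J (if τ = 0 then (if σ = 0 then D.erase x else insert x D).erase y
        else insert y (if σ = 0 then D.erase x else insert x D)) := by
    rw [← spinConfig_insert_erase, ← spinConfig_insert_erase, Finset.filter_insert,
      if_pos (by simpa using hxy)]
  have h1 := h (siteX x) (siteX y)
  have e0 : insert y (D.erase x) = if (1 : Spin) = 0 then
      (if (0 : Spin) = 0 then D.erase x else insert x D).erase y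
        else insert y (if (0 : Spin) = 0 then D.erase x else insert x D) := by simp
  have e1 : D = if (0 : Spin) = 0 then
      (if (1 : Spin) = 0 then D.erase x else insert x D).erase y
        else insert y (if (1 : Spin) = 0 then D.erase x else insert x D) := by
    simp [Finset.insert_eq_of_mem hx, Finset.erase_eq_of_notMem hy]
  rw [e1, ← key2, ← key, ← h1, key, key2, ← e0] at h0
  exact h0

lemma spinConfig_eq_zero_of_card {ψ : ElectronSpace (Site J E)} (h : IsSpinSymmetric ψ)
    {D D' : Finset E} (hc : D.card = D'.card) (h0 : ψ (spinConfig J D) = 0) :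
    ψ (spinConfig J D') = 0 := by
  induction hk : (D \ D').card generalizing D with
  | zero =>
    have h1 : D ⊆ D' := by simpa using hk
    rwa [← Finset.eq_of_subset_of_card_le h1 hc.ge]
  | succ k ih =>
    obtain ⟨x, hx⟩ : (D \ D').Nonempty := Finset.card_pos.mp (by omega)
    obtain ⟨y, hy⟩ : (D' \ D).Nonempty := by
      rw [← Finset.card_pos, ← Finset.card_sdiff_comm hc]
      omega
    simp only [Finset.mem_sdiff] at hx hy
    refine ih (D := insert y (D.erase x)) ?_ (spinConfig_move h hx.1 hy.2 h0) ?_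
    · rw [Finset.card_insert_of_notMem (by simp [hy.2]), Finset.card_erase_add_one hx.1, hc]
    · have h2 : insert y (D.erase x) \ D' = (D \ D').erase x := by
        rw [Finset.insert_sdiff_of_mem _ hy.1, Finset.erase_sdiff_comm]
      rw [h2, Finset.card_erase_of_mem (by simp [hx]), hk]
      rfl

end CellLattice

/-! ### Projection to a given number of down spins -/

section DownSpins

variable {Λ : Type*} [Fintype Λ]

/-- The number of electrons with spin down in a configuration. -/
def downCount (A : Finset (Λ × Spin)) : ℕ := ∑ k ∈ A, k.2.val

/-- The projection to the configurations `A` with `downCount A + a = k`. The shift `a` makes it easy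
to move annihilation operators past the projection. -/
noncomputable def downProj (a k : ℕ) (ψ : ElectronSpace Λ) : ElectronSpace Λ :=
  WithLp.toLp 2 fun A => if downCount A + a = k then ψ A else 0

lemma downProj_apply (a k : ℕ) (ψ : ElectronSpace Λ) (A : Finset (Λ × Spin)) :
    downProj a k ψ A = if downCount A + a = k then ψ A else 0 := rfl

lemma downProj_zero (a k : ℕ) : downProj a k (0 : ElectronSpace Λ) = 0 := by
  ext A
  simp [downProj_apply]

lemma downProj_add (a k : ℕ) (ψ φ : ElectronSpace Λ) :
    downProj a k (ψ + φ) = downProj a k ψ + downProj a k φ := by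
  ext A
  simp only [downProj_apply, PiLp.add_apply]
  split_ifs <;> simp

lemma downProj_smul (a k : ℕ) (z : ℂ) (ψ : ElectronSpace Λ) :
    downProj a k (z • ψ) = z • downProj a k ψ := by
  ext A
  simp only [downProj_apply, PiLp.smul_apply]
  split_ifs <;> simp

lemma downProj_mem_sector {N : ℕ} {ψ : ElectronSpace Λ} [DecidableEq Λ] (h : ψ ∈ sector Λ N)
    (a k : ℕ) : downProj a k ψ ∈ sector Λ N := by
  rw [mem_sector_iff] at h ⊢
  intro A hA
  simp [downProj_apply, h A hA]

lemma c_downProj [DecidableEq Λ] (r : Λ) (σ : Spin) (a k : ℕ) (ψ : ElectronSpace Λ) :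
    c r σ (downProj a k ψ) = downProj (a + σ.val) k (c r σ ψ) := by
  ext A
  rw [downProj_apply, c, annihilate_apply, annihilate_apply, downProj_apply]
  by_cases h : (r, σ) ∈ A
  · simp [h]
  · have h1 : downCount (insert (r, σ) A) + a = downCount A + (a + σ.val) := by
      rw [downCount, Finset.sum_insert h, downCount]
      ring
    rw [if_neg h, if_neg h, h1, mul_ite, mul_zero]

end DownSpins

namespace CellLattice

lemma downCount_spinConfig {J E : Type*} [DecidableEq J] [Fintype E] [DecidableEq E]
    (D : Finset E) : downCount (spinConfig J D) = D.card := by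
  rw [downCount, spinConfig, Finset.sum_image (fun x _ y _ h => by simpa using congrArg Prod.fst h)]
  simp [apply_ite Fin.val]

/-! ### A flat-band Slater determinant -/

variable {n m : ℕ} {J E : Type*} [Fintype J] [DecidableEq J] [Fintype E] [DecidableEq E]
  (L : CellLattice n m J E)

open Classical in
/-- The flat-band wave function localized at the external site `x` and the internal sites of the
cells to which `x` belongs. -/
noncomputable def localizedWave (ν : ℝ) (x : E) : Site J E → ℝ :=
  Sum.elim (fun j => if x ∈ Set.range (L.ext (j.elim id id)) then -ν / 2 else 0)
    (fun y => if y = x then 1 else 0)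

/-- The adjoint creates an electron in the state `localizedWave`, with its spin in the direction of
the first coordinate axis. -/
noncomputable def annihilateLocalized (ν : ℝ) (x : E) : Module.End ℂ (ElectronSpace (Site J E)) :=
  annihilateWave fun k => (L.localizedWave ν x k.1 : ℂ)

/-- The Slater determinant of the localized flat-band states at the external sites in the list,
all spins pointing in the direction of the first coordinate axis. -/
noncomputable def slater (ν : ℝ) : List E → ElectronSpace (Site J E)
  | [] => vacuum _
  | x :: l => LinearMap.adjoint (L.annihilateLocalized ν x) (slater ν l)

variable {L} {ν : ℝ}

lemma c_adjoint_annihilateLocalized (r : Site J E) (σ : Spin) (x : E)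
    (ψ : ElectronSpace (Site J E)) :
    c r σ (LinearMap.adjoint (L.annihilateLocalized ν x) ψ)
      = (L.localizedWave ν x r : ℂ) • ψ
        - LinearMap.adjoint (L.annihilateLocalized ν x) (c r σ ψ) := by
  rw [c, annihilateLocalized, annihilate_adjoint_annihilateWave]
  simp

lemma slater_mem_flatSpace (l : List E) : L.slater ν l ∈ L.flatSpace ν := by
  rw [mem_flatSpace_iff]
  intro j σ
  induction l with
  | nil => simp [slater, b_apply, d_apply, c, annihilate_vacuum]
  | cons x l ih =>
    rw [slater, b_apply, d_apply]
    rw [b_apply, d_apply] at ih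
    have hU : L.localizedWave ν x (siteU j) = L.localizedWave ν x (siteV j) := rfl
    have hsum : L.localizedWave ν x (siteU j) + L.localizedWave ν x (siteV j)
        + ν * ∑ i, L.localizedWave ν x (siteX (L.ext j i)) = 0 := by
      by_cases hx : x ∈ Set.range (L.ext j)
      · obtain ⟨i, rfl⟩ := hx
        simp [localizedWave, (L.ext_injective j).eq_iff]
      · have : ∀ i, L.ext j i ≠ x := by simpa using hx
        simp [localizedWave, this]
    constructor
    · have h1 := congrArg (LinearMap.adjoint (L.annihilateLocalized ν x)) ih.1
      simp only [map_add, map_smul, map_sum, map_zero] at h1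
      have h2 := congrArg (fun a : ℝ => (a : ℂ) • L.slater ν l) hsum
      push_cast at h2
      rw [zero_smul, add_smul, add_smul, mul_smul, Finset.sum_smul] at h2
      simp only [c_adjoint_annihilateLocalized, Finset.sum_sub_distrib, smul_sub]
      linear_combination (norm := module) h2 - h1
    · rw [c_adjoint_annihilateLocalized, c_adjoint_annihilateLocalized, hU, sub_sub_sub_cancel_left,
        ← map_sub, ← neg_sub, ih.2]
      simp

lemma c_slater (r : Site J E) (l : List E) : c r 0 (L.slater ν l) = c r 1 (L.slater ν l) := by
  induction l with
  | nil => simp [slater, c, annihilate_vacuum]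
  | cons x l ih => rw [slater, c_adjoint_annihilateLocalized, c_adjoint_annihilateLocalized, ih]

lemma slater_noDoubleOccupancy (l : List E) : NoDoubleOccupancy (L.slater ν l) := fun r => by
  rw [c_slater]
  exact annihilate_annihilate _ _

lemma slater_mem_sector (l : List E) : L.slater ν l ∈ sector _ l.length := by
  rw [mem_sector_iff]
  induction l with
  | nil =>
    intro A hA
    have : A ≠ ∅ := by rintro rfl; exact hA rfl
    simp [slater, vacuum_apply, this]
  | cons x l ih =>
    intro A hA
    rw [slater, annihilateLocalized, adjoint_annihilateWave_apply]
    simp only [WithLp.ofLp_sum, Finset.sum_apply, PiLp.smul_apply, adjoint_annihilate_apply]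
    refine Finset.sum_eq_zero fun k _ => ?_
    split_ifs with hk
    · rw [ih, mul_zero, smul_zero]
      intro h
      apply hA
      rw [List.length_cons, ← h, Finset.card_erase_add_one hk]
    · exact smul_zero _

lemma c_slater_of_notMem {l : List E} {y : E} (hy : y ∉ l) (σ : Spin) :
    c (siteX y) σ (L.slater ν l) = 0 := by
  induction l with
  | nil => simp [slater, c, annihilate_vacuum]
  | cons x l ih =>
    rw [List.mem_cons, not_or] at hy
    rw [slater, c_adjoint_annihilateLocalized, ih hy.2]
    simp [localizedWave, hy.1]

lemma slater_ne_zero {l : List E} (hl : l.Nodup) : L.slater ν l ≠ 0 := by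
  induction l with
  | nil =>
    intro h
    simpa [slater, vacuum_apply] using congrArg (fun φ : ElectronSpace (Site J E) => φ ∅) h
  | cons x l ih =>
    rw [List.nodup_cons] at hl
    intro h
    apply ih hl.2
    have h1 := c_adjoint_annihilateLocalized (L := L) (ν := ν) (siteX x) 0 x (L.slater ν l)
    rw [← slater, h, c_slater_of_notMem hl.1] at h1
    simpa [localizedWave] using h1.symm

/-! ### The energy form -/

variable {t s' U : ℝ}

lemma inner_hamiltonian (ψ : ElectronSpace (Site J E)) :
    inner ℂ ψ (L.hamiltonian ν t s' U ψ)
      = ((t * ∑ j, ∑ σ, ‖L.b ν j σ ψ‖ ^ 2 + s' * ∑ j, ∑ σ, ‖L.d j σ ψ‖ ^ 2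
        + U * ∑ r, ‖c r 1 (c r 0 ψ)‖ ^ 2 : ℝ) : ℂ) := by
  simp only [hamiltonian, num_mul_num, LinearMap.add_apply, LinearMap.smul_apply,
    LinearMap.sum_apply, inner_add_right, inner_smul_right, inner_sum, inner_adjoint_mul_self]
  simp

lemma mem_energySpace_zero_iff (ht : 0 < t) (hs' : 0 < s') (hU : 0 < U) {N : ℕ}
    {ψ : ElectronSpace (Site J E)} :
    ψ ∈ energySpace (L.hamiltonian ν t s' U) N 0 ↔
      ψ ∈ L.flatSpace ν ∧ ψ ∈ sector _ N ∧ NoDoubleOccupancy ψ := by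
  rw [energySpace, Submodule.mem_inf, Module.End.mem_eigenspace_iff, Complex.ofReal_zero, zero_smul]
  constructor
  · rintro ⟨hN, h⟩
    have h1 := inner_hamiltonian (L := L) (ν := ν) (t := t) (s' := s') (U := U) ψ
    rw [h, inner_zero_right, eq_comm, Complex.ofReal_eq_zero] at h1
    have hb : 0 ≤ ∑ j, ∑ σ, ‖L.b ν j σ ψ‖ ^ 2 := by positivity
    have hd : 0 ≤ ∑ j, ∑ σ, ‖L.d j σ ψ‖ ^ 2 := by positivity
    have hn : 0 ≤ ∑ r, ‖c r 1 (c r 0 ψ)‖ ^ 2 := by positivity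
    have hb' := mul_nonneg ht.le hb
    have hd' := mul_nonneg hs'.le hd
    have hn' := mul_nonneg hU.le hn
    have hb0 : ∑ j, ∑ σ, ‖L.b ν j σ ψ‖ ^ 2 = 0 :=
      (mul_eq_zero.mp (by linarith : t * _ = 0)).resolve_left ht.ne'
    have hd0 : ∑ j, ∑ σ, ‖L.d j σ ψ‖ ^ 2 = 0 :=
      (mul_eq_zero.mp (by linarith : s' * _ = 0)).resolve_left hs'.ne'
    have hn0 : ∑ r, ‖c r 1 (c r 0 ψ)‖ ^ 2 = 0 :=
      (mul_eq_zero.mp (by linarith : U * _ = 0)).resolve_left hU.ne'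
    rw [Finset.sum_eq_zero_iff_of_nonneg (fun _ _ => by positivity)] at hb0 hd0 hn0
    refine ⟨mem_flatSpace_iff.mpr fun j σ => ⟨?_, ?_⟩, hN, fun r => ?_⟩
    · have := hb0 j (Finset.mem_univ _)
      rw [Finset.sum_eq_zero_iff_of_nonneg (fun _ _ => by positivity)] at this
      simpa using this σ (Finset.mem_univ _)
    · have := hd0 j (Finset.mem_univ _)
      rw [Finset.sum_eq_zero_iff_of_nonneg (fun _ _ => by positivity)] at this
      simpa using this σ (Finset.mem_univ _)
    · simpa using hn0 r (Finset.mem_univ _)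
  · rintro ⟨hF, hN, hD⟩
    rw [mem_flatSpace_iff] at hF
    have hD' (r : Site J E) : c r 1 (c r 0 ψ) = 0 := hD r
    refine ⟨hN, ?_⟩
    simp [hamiltonian, num_mul_num, (hF _ _).1, (hF _ _).2, hD']

lemma nonneg_of_hamiltonian_eq (ht : 0 < t) (hs' : 0 < s') (hU : 0 < U) {η : ℝ}
    {ψ : ElectronSpace (Site J E)} (h0 : ψ ≠ 0)
    (h : L.hamiltonian ν t s' U ψ = (η : ℂ) • ψ) : 0 ≤ η := by
  have h1 := inner_hamiltonian (L := L) (ν := ν) (t := t) (s' := s') (U := U) ψ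
  rw [h, inner_smul_right, inner_self_eq_norm_sq_to_K] at h1
  have h2 : η * ‖ψ‖ ^ 2 = t * ∑ j, ∑ σ, ‖L.b ν j σ ψ‖ ^ 2
      + s' * ∑ j, ∑ σ, ‖L.d j σ ψ‖ ^ 2 + U * ∑ r, ‖c r 1 (c r 0 ψ)‖ ^ 2 := by
    apply Complex.ofReal_injective
    rw [← h1]
    push_cast
    rfl
  have h3 : 0 ≤ η * ‖ψ‖ ^ 2 := by rw [h2]; positivity
  exact nonneg_of_mul_nonneg_left h3 (by positivity)

/-! ### The ground states -/

lemma slater_mem_energySpace (ht : 0 < t) (hs' : 0 < s') (hU : 0 < U) :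
    L.slater ν Finset.univ.toList
      ∈ energySpace (L.hamiltonian ν t s' U) (Fintype.card E) 0 := by
  rw [mem_energySpace_zero_iff ht hs' hU]
  refine ⟨slater_mem_flatSpace _, ?_, slater_noDoubleOccupancy _⟩
  simpa using slater_mem_sector (L := L) (ν := ν) Finset.univ.toList

lemma downProj_mem_energySpace (ht : 0 < t) (hs' : 0 < s') (hU : 0 < U) {N : ℕ}
    {ψ : ElectronSpace (Site J E)} (h : ψ ∈ energySpace (L.hamiltonian ν t s' U) N 0) (k : ℕ) :
    downProj 0 k ψ ∈ energySpace (L.hamiltonian ν t s' U) N 0 := by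
  rw [mem_energySpace_zero_iff ht hs' hU, mem_flatSpace_iff] at *
  obtain ⟨hF, hN, hD⟩ := h
  have hsum (a : ℕ) (f : Fin n → ElectronSpace (Site J E)) :
      downProj a k (∑ i, f i) = ∑ i, downProj a k (f i) :=
    map_sum (AddMonoidHom.mk' (downProj a k) (downProj_add a k)) f _
  refine ⟨fun j σ => ⟨?_, ?_⟩, downProj_mem_sector hN 0 k, fun r => ?_⟩
  · have h1 := congrArg (downProj (0 + σ.val) k) (hF j σ).1
    rw [b_apply, downProj_add, downProj_add, downProj_smul, hsum, downProj_zero] at h1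
    simpa only [b_apply, c_downProj] using h1
  · have h1 := congrArg (downProj (0 + σ.val) k) (hF j σ).2
    rw [d_apply, sub_eq_add_neg, ← neg_one_smul ℂ, downProj_add, downProj_smul,
      downProj_zero] at h1
    rw [d_apply, sub_eq_add_neg, ← neg_one_smul ℂ, c_downProj, c_downProj, h1]
  · rw [c_downProj, c_downProj, hD r, downProj_zero]

lemma spinConfig_eq_zero_iff_insert {ψ : ElectronSpace (Site J E)}
    (h : ∀ r, c r 0 ψ = c r 1 ψ) (D : Finset E) {x : E} (hx : x ∉ D) :
    ψ (spinConfig J (insert x D)) = 0 ↔ ψ (spinConfig J D) = 0 := by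
  have h0 := spinConfig_insert_erase (J := J) D x 0
  have h1 := spinConfig_insert_erase (J := J) D x 1
  rw [if_pos rfl, Finset.erase_eq_of_notMem hx] at h0
  rw [if_neg (by decide)] at h1
  rw [← h0, ← h1, ← c_apply_eq_zero_iff (by simp), ← c_apply_eq_zero_iff (by simp), h]

lemma slater_spinConfig_ne_zero (D : Finset E) :
    L.slater ν Finset.univ.toList (spinConfig J D) ≠ 0 := by
  have h1 (D : Finset E) : L.slater ν Finset.univ.toList (spinConfig J D) = 0 ↔
      L.slater ν Finset.univ.toList (spinConfig J ∅) = 0 := by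
    induction D using Finset.induction_on with
    | empty => rfl
    | insert x D hx ih =>
      rw [spinConfig_eq_zero_iff_insert (fun r => c_slater r _) D hx, ih]
  intro h
  refine slater_ne_zero (L := L) (ν := ν) (Finset.nodup_toList Finset.univ) ?_
  refine eq_zero_of_spinConfig (slater_mem_flatSpace _) ?_ (slater_noDoubleOccupancy _)
    fun D' => (h1 D').mpr ((h1 D).mp h)
  simpa using slater_mem_sector (L := L) (ν := ν) Finset.univ.toList

/-- A ground state is determined by one amplitude for each number of down spins, and the projections
of the Slater determinant show that these amplitudes are independent. -/
lemma finrank_energySpace (hL : L.graph.Connected) (hν : ν ≠ 0) (ht : 0 < t) (hs' : 0 < s')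
    (hU : 0 < U) :
    Module.finrank ℂ (energySpace (L.hamiltonian ν t s' U) (Fintype.card E) 0)
      = Fintype.card E + 1 := by
  have hex (k : Fin (Fintype.card E + 1)) : ∃ D : Finset E, D.card = k := by
    obtain ⟨D, -, hD⟩ := Finset.exists_subset_card_eq (s := (Finset.univ : Finset E)) (n := k)
      (by rw [Finset.card_univ]; omega)
    exact ⟨D, hD⟩
  choose D hD using hex
  let T : energySpace (L.hamiltonian ν t s' U) (Fintype.card E) 0 →ₗ[ℂ]
      (Fin (Fintype.card E + 1) → ℂ) :=
    { toFun := fun ψ k => ψ.1 (spinConfig J (D k))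
      map_add' := fun _ _ => rfl
      map_smul' := fun _ _ => rfl }
  have hinj : Function.Injective T := by
    rw [← LinearMap.ker_eq_bot, LinearMap.ker_eq_bot']
    rintro ⟨ψ, hψ⟩ hT
    obtain ⟨hF, hN, hd⟩ := (mem_energySpace_zero_iff ht hs' hU).mp hψ
    refine Subtype.ext (eq_zero_of_spinConfig hF hN hd fun D' => ?_)
    have hlt : D'.card < Fintype.card E + 1 := Nat.lt_succ_of_le (Finset.card_le_univ D')
    exact spinConfig_eq_zero_of_card (isSpinSymmetric hL hν hF hN hd) (hD ⟨_, hlt⟩)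
      (congrFun hT ⟨_, hlt⟩)
  have hsurj : Function.Surjective T := by
    have hv (k : Fin (Fintype.card E + 1)) := downProj_mem_energySpace (L := L) (ν := ν) ht hs' hU
      (slater_mem_energySpace ht hs' hU) k
    have hTv (k l : Fin (Fintype.card E + 1)) : T ⟨_, hv k⟩ l
        = if k = l then L.slater ν Finset.univ.toList (spinConfig J (D l)) else 0 := by
      change downProj 0 k (L.slater ν Finset.univ.toList) (spinConfig J (D l)) = _
      rw [downProj_apply, downCount_spinConfig, hD, add_zero]
      simp only [Fin.val_inj, eq_comm]
    intro f
    refine ⟨∑ k, (f k / L.slater ν Finset.univ.toList (spinConfig J (D k))) • ⟨_, hv k⟩, ?_⟩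
    ext l
    rw [map_sum, Finset.sum_apply]
    simp only [map_smul, Pi.smul_apply, hTv, smul_eq_mul, mul_ite, mul_zero, Finset.sum_ite_eq',
      Finset.mem_univ, if_true]
    exact div_mul_cancel₀ _ (slater_spinConfig_ne_zero _)
  rw [(LinearEquiv.ofBijective T ⟨hinj, hsurj⟩).finrank_eq, Module.finrank_fin_fun]

end CellLattice

/-! ### Counting sites -/

/-- Count the incident pairs of a cell and an external site in two ways. -/
lemma CellLattice.card_mul_eq {n m : ℕ} {J E : Type*} [Fintype J] [Fintype E]
    (L : CellLattice n m J E) : Fintype.card E * m = Fintype.card J * n := by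
  classical
  have h1 (x : E) : (Finset.univ.filter fun j => x ∈ Set.range (L.ext j)).card = m := by
    refine Eq.trans ?_ (L.shared x)
    rw [← Set.ncard_coe_finset, Finset.coe_filter_univ]
  have h2 (j : J) : (Finset.univ.filter fun x => x ∈ Set.range (L.ext j)).card = n := by
    have : (Finset.univ.filter fun x => x ∈ Set.range (L.ext j)) = Finset.univ.image (L.ext j) := by
      ext; simp
    rw [this, Finset.card_image_of_injective _ (L.ext_injective j), Finset.card_univ,
      Fintype.card_fin]
  have h3 := Finset.sum_card_bipartiteAbove_eq_sum_card_bipartiteBelow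
    (s := (Finset.univ : Finset E)) (t := (Finset.univ : Finset J))
    (fun x j => x ∈ Set.range (L.ext j))
  simp only [Finset.bipartiteAbove, Finset.bipartiteBelow, h1, h2, Finset.sum_const,
    Finset.card_univ, smul_eq_mul] at h3
  exact h3
end FlatBand

theorem theorem1 {J E : Type*} [Fintype J] [DecidableEq J] [Fintype E] [DecidableEq E]
    (n m : ℕ) (hn : 0 < n) (hm : 0 < m)
    (L : FlatBand.CellLattice n m J E) (hL : L.graph.Connected)
    (ν t s' : ℝ) (hν : 0 < ν) (ht : 0 < t) (hs' : 0 < s')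
    (Ne : ℕ) (hNe : Ne = Fintype.card E) (Smax : ℝ) (hSmax : Smax = (Ne : ℝ) / 2) :
    (Ne : ℝ) = n * (Fintype.card (FlatBand.Site J E) : ℝ) / (2 * m + n) ∧
    ∀ U : ℝ, 0 < U →
      ∃ ε : ℝ, FlatBand.IsGroundEnergy (L.hamiltonian ν t s' U) Ne ε ∧
        (∀ ψ ∈ FlatBand.energySpace (L.hamiltonian ν t s' U) Ne ε,
          FlatBand.HasTotalSpin ψ Smax) ∧
        (Module.finrank ℂ (FlatBand.energySpace (L.hamiltonian ν t s' U) Ne ε) : ℝ)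
          = 2 * Smax + 1 := by
  subst hNe hSmax
  constructor
  · have h1 : (Fintype.card E : ℝ) * m = Fintype.card J * n := by
      exact_mod_cast L.card_mul_eq
    have h2 : (2 * m + n : ℝ) ≠ 0 := by positivity
    rw [eq_div_iff h2]
    simp only [Fintype.card_sum]
    push_cast
    linear_combination 2 * h1
  · intro U hU
    refine ⟨0, ⟨?_, ?_⟩, fun ψ hψ => ?_, ?_⟩
    · have h := FlatBand.CellLattice.slater_mem_energySpace (L := L) (ν := ν) ht hs' hU
      exact ⟨_, h.1, FlatBand.CellLattice.slater_ne_zero (Finset.nodup_toList _),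
        Module.End.mem_eigenspace_iff.mp h.2⟩
    · rintro η ⟨ψ, -, h0, h⟩
      exact FlatBand.CellLattice.nonneg_of_hamiltonian_eq ht hs' hU h0 h
    · obtain ⟨hF, hN, hD⟩ := (FlatBand.CellLattice.mem_energySpace_zero_iff ht hs' hU).mp hψ
      exact (FlatBand.CellLattice.isSpinSymmetric hL hν.ne' hF hN hD).hasTotalSpin hN
    · rw [FlatBand.CellLattice.finrank_energySpace hL hν.ne' ht hs' hU]
      push_cast
      ring
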